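/- Let $\mathbb{F}=\mathbb{F}_q$, let $\mathbb{F}_{q^m}$ be its extension of degree $m$, and let $G\in\mathbb{F}_{q^m}^{k\times n}$ have rank $k$. Let $\mathcal{C}=\{uG\mid u\in\mathbb{F}_{q^m}^k\}$. Let $\mathcal{M}=\mathcal{M}_G=(\mathbb{F}^n,\rho)$ be the $q$-matroid represented by $G$, i.e. $\rho(\mathrm{rowsp}(Y))=\mathrm{rk}_{\mathbb{F}_{q^m}}(GY^{\mathsf T})$ for every matrix $Y$ over $\mathbb{F}$ with $n$ columns, and let $$R_{\mathcal{M}}=\sum_{V\leq\mathbb{F}^n}x^{k-\rho(V)}y^{\dim V-\rho(V)}\in\mathbb{Z}[x,y]$$ be its Whitney function. Fix an $\mathbb{F}$-basis of $\mathbb{F}_{q^m}$, and for $v\in\mathbb{F}_{q^m}^n$ let $\Psi(v)\in\mathbb{F}^{m\times n}$ be the matrix whose columns are the coordinate vectors of the entries of $v$. The rank weight of an $\mathbb{F}_{q^m}$-subspace $T\leq\mathbb{F}_{q^m}^n$ is $\mathrm{wt}_{\mathrm{rk}}(T)=\dim_{\mathbb{F}}\sum_{v\in T}\mathrm{rowsp}(\Psi(v))$.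 For $t\in\{0,\dots,k\}$ let $A_i^{(t)}$ be the number of $t$-dimensional $\mathbb{F}_{q^m}$-subspaces of $\mathcal{C}$ of rank weight $i$, and let $W_{\mathcal{C}}^{(t)}=\sum_{i=0}^nA_i^{(t)}x^{n-i}y^i\in\mathbb{Z}[x,y]$ be the $t$-th higher rank-weight enumerator of $\mathcal{C}$. For a family $\mathcal{U}=(u_{i,j})_{i,j\in\mathbb{N}_0}$ in $\mathbb{Z}[x,y]$ let $\Omega_{\mathcal{U}}$ be the $\mathbb{Z}$-linear map $\mathbb{Z}[x,y]\to\mathbb{Z}[x,y]$ with $x^iy^j\mapsto u_{i,j}$ (a monomial substitution). Let $\left[{a\atop b}\right]_Q$ denote the Gaussian binomial coefficient in $Q$, which is $0$ if $b>a$; a summand below that contains a vanishing Gaussian binomial coefficient is read as $0$. Then: (a) For every $t\in\{0,\dots,k\}$ one has $W_{\mathcal{C}}^{(t)}=\Omega_{\mathcal{U}^{(t)}}(R_{\mathcal{M}})$, where $\mathcal{U}^{(t)}=(u^{(t)}_{a,c})_{a,c\in\mathbb{N}_0}$ with $$u^{(t)}_{a,c}=\sum_{i=0}^n(-1)^{i-n+k-a+c}\,q^{\binom{i-n+k-a+c}{2}}\left[{k-a+c\atop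 n-i}\right]_q\left[{a\atop t}\right]_{q^m}x^{n-i}y^i$$ if $0\leq a\leq k$ and $0\leq c\leq n-k$, and $u^{(t)}_{a,c}=0$ otherwise. (b) Conversely, $R_{\mathcal{M}}=\sum_{t=0}^k\Omega_{\widehat{\mathcal{U}}^{(t)}}(W_{\mathcal{C}}^{(t)})$, where $\widehat{\mathcal{U}}^{(t)}=(\hat u^{(t)}_{i,j})_{i,j\in\mathbb{N}_0}$ with $$\hat u^{(t)}_{i,j}=\sum_{a=0}^k\sum_{c=0}^{n-k}(-1)^{t-a}\,q^{m\binom{t-a}{2}}\left[{t\atop a}\right]_{q^m}\left[{n-j\atop k+c-a}\right]_q x^ay^c$$ if $i+j=n$, and $\hat u^{(t)}_{i,j}=0$ otherwise. -/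

import Mathlib

open scoped Matrix

noncomputable section

/-! ### Row spaces and Gaussian binomial coefficients -/

/-- The row space `{u M | u}` of a matrix `M`. -/
def rowSpace {K : Type*} [Field K] {r n : ℕ} (M : Matrix (Fin r) (Fin n) K) :
    Submodule K (Fin n → K) :=
  LinearMap.range M.vecMulLinear

/-- The Gaussian binomial coefficient, by the `q`-Pascal recursion; it vanishes for lower index
larger than the upper one. -/
def gaussBinom (q : ℕ) : ℕ → ℕ → ℕ
  | _, 0 => 1
  | 0, _ + 1 => 0
  | n + 1, j + 1 => gaussBinom q n j + q ^ (j + 1) * gaussBinom q n (j + 1)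

/-- The product formula for the Gaussian binomial coefficient. -/
theorem gaussBinom_mul_prod (q n j : ℕ) :
    (gaussBinom q n j : ℤ) * ∏ i ∈ Finset.range j, ((q : ℤ) ^ (i + 1) - 1) =
      ∏ i ∈ Finset.range j, ((q : ℤ) ^ (n - i) - 1) := by
  induction n generalizing j with
  | zero =>
    cases j with
    | zero => simp [gaussBinom]
    | succ j => simp [gaussBinom]
  | succ n ih =>
    cases j with
    | zero => simp [gaussBinom]
    | succ j =>
      have h1 := ih j
      have h2 := ih (j + 1)
      rw [Finset.prod_range_succ, Finset.prod_range_succ (fun i => (q : ℤ) ^ (n - i) - 1)] at h2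
      have h3 : ∏ i ∈ Finset.range (j + 1), ((q : ℤ) ^ (n + 1 - i) - 1) =
          ((q : ℤ) ^ (n + 1) - 1) * ∏ i ∈ Finset.range j, ((q : ℤ) ^ (n - i) - 1) := by
        rw [Finset.prod_range_succ', mul_comm]
        simp
      rw [h3, Finset.prod_range_succ, gaussBinom]
      push_cast
      rcases le_or_gt j n with hj | hj
      · have h4 : (q : ℤ) ^ (n + 1) = (q : ℤ) ^ (j + 1) * (q : ℤ) ^ (n - j) := by
          rw [← pow_add]; congr 1; omega
        rw [h4]
        linear_combination ((q : ℤ) ^ (j + 1) - 1) * h1 + (q : ℤ) ^ (j + 1) * h2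
      · have h5 : ∏ i ∈ Finset.range j, ((q : ℤ) ^ (n - i) - 1) = 0 :=
          Finset.prod_eq_zero (Finset.mem_range.mpr hj) (by simp)
        rw [h5] at h1 h2 ⊢
        linear_combination ((q : ℤ) ^ (j + 1) - 1) * h1 + (q : ℤ) ^ (j + 1) * h2

/-! ### Monomial substitutions of `ℤ[x, y]`, with `x = X 0` and `y = X 1` -/

/-- The `ℤ`-linear map `∑ f i j • x ^ i * y ^ j ↦ ∑ f i j • u i j`. -/
def monomialSubst (u : ℕ → ℕ → MvPolynomial (Fin 2) ℤ) :
    MvPolynomial (Fin 2) ℤ →ₗ[ℤ] MvPolynomial (Fin 2) ℤ :=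
  (MvPolynomial.basisMonomials (Fin 2) ℤ).constr ℤ fun d => u (d 0) (d 1)

theorem monomialSubst_monomial (u : ℕ → ℕ → MvPolynomial (Fin 2) ℤ) (i j : ℕ) :
    monomialSubst u (MvPolynomial.X 0 ^ i * MvPolynomial.X 1 ^ j) = u i j := by
  have h : (MvPolynomial.X 0 ^ i * MvPolynomial.X 1 ^ j : MvPolynomial (Fin 2) ℤ) =
      MvPolynomial.basisMonomials (Fin 2) ℤ (Finsupp.single 0 i + Finsupp.single 1 j) := by
    simp [MvPolynomial.X_pow_eq_monomial, MvPolynomial.monomial_mul]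
  rw [h, monomialSubst, Module.Basis.constr_basis]
  simp

/-! ### `q`-matroids -/

/-- A `q`-matroid with ground space `E`, given by its rank function. -/
structure QMatroid (F E : Type*) [Field F] [AddCommGroup E] [Module F E] where
  rank : Submodule F E → ℕ
  rank_le_finrank : ∀ V, rank V ≤ Module.finrank F V
  rank_mono : ∀ V W, V ≤ W → rank V ≤ rank W
  rank_submodular : ∀ V W, rank (V ⊔ W) + rank (V ⊓ W) ≤ rank V + rank W

/-- The Whitney function `∑ x ^ (ρ E - ρ V) * y ^ (dim V - ρ V)` over all subspaces `V ≤ E`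
(finitely many of them when `F` is finite and `E` is finite-dimensional). -/
def QMatroid.whitney {F E : Type*} [Field F] [AddCommGroup E] [Module F E]
    (M : QMatroid F E) : MvPolynomial (Fin 2) ℤ :=
  ∑ᶠ V : Submodule F E, MvPolynomial.X 0 ^ (M.rank ⊤ - M.rank V) *
    MvPolynomial.X 1 ^ (Module.finrank F V - M.rank V)

/-- For a matrix `G` over an extension `L` of `F` and `V ≤ F ^ n`, the `L`-span of all `G vᵀ`
with `v ∈ V`. -/
def imageSpan {F L : Type*} [Field F] [Field L] [Algebra F L] {k n : ℕ}
    (G : Matrix (Fin k) (Fin n) L) (V : Submodule F (Fin n → F)) : Submodule L (Fin k → L) :=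
  Submodule.span L ((fun v : Fin n → F => G *ᵥ (algebraMap F L ∘ v)) '' (V : Set (Fin n → F)))

/-- If `V` is the row space of `Y`, then `imageSpan G V` is the column space of `G Yᵀ`. -/
theorem imageSpan_rowSpace {F L : Type*} [Field F] [Field L] [Algebra F L] {k n r : ℕ}
    (G : Matrix (Fin k) (Fin n) L) (Y : Matrix (Fin r) (Fin n) F) :
    imageSpan G (rowSpace Y) =
      LinearMap.range (G * (Y.map (algebraMap F L))ᵀ).mulVecLin := by
  have key : ∀ u : Fin r → F, G *ᵥ (algebraMap F L ∘ (u ᵥ* Y)) =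
      (G * (Y.map (algebraMap F L))ᵀ) *ᵥ (algebraMap F L ∘ u) := by
    intro u
    rw [← Matrix.mulVec_mulVec, Matrix.mulVec_transpose]
    congr 1
    ext j
    simp [Matrix.vecMul, dotProduct]
  apply le_antisymm
  · rw [imageSpan, Submodule.span_le]
    rintro _ ⟨_, ⟨u, rfl⟩, rfl⟩
    exact ⟨algebraMap F L ∘ u, (key u).symm⟩
  · rw [Matrix.range_mulVecLin, Submodule.span_le]
    rintro _ ⟨i, rfl⟩
    apply Submodule.subset_span
    refine ⟨_, ⟨Pi.single i 1, rfl⟩, ?_⟩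
    have h := key (Pi.single i 1)
    have h2 : (algebraMap F L ∘ (Pi.single i (1 : F) : Fin r → F)) = Pi.single i 1 := by
      ext j
      by_cases hj : j = i
      · subst hj; simp
      · simp [hj]
    rw [h2, Matrix.mulVec_single_one] at h
    exact h

/-- The `q`-matroid represented by `G`, with ground space `F ^ n`. -/
def QMatroid.ofMatrix (F : Type*) {L : Type*} [Field F] [Field L] [Algebra F L] {k n : ℕ}
    (G : Matrix (Fin k) (Fin n) L) : QMatroid F (Fin n → F) where
  rank V := Module.finrank L (imageSpan G V)
  rank_le_finrank V := by
    let B := Module.finBasis F V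
    let Y : Matrix (Fin (Module.finrank F V)) (Fin n) F := fun i => (B i : Fin n → F)
    have hV : rowSpace Y = V := by
      have h1 : rowSpace Y = Submodule.span F (Set.range Y) := by
        rw [rowSpace, range_vecMulLinear]
        rfl
      have h2 : Set.range Y = V.subtype '' Set.range B := by
        rw [← Set.range_comp]; rfl
      rw [h1, h2, Submodule.span_image, B.span_eq, Submodule.map_top, Submodule.range_subtype]
    have h := imageSpan_rowSpace G Y
    rw [hV] at h
    rw [h]
    exact (Matrix.rank_le_card_width _).trans (by simp)
  rank_mono V W h := Submodule.finrank_mono (Submodule.span_mono (Set.image_mono h))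
  rank_submodular V W := by
    have hsup : imageSpan G (V ⊔ W) ≤ imageSpan G V ⊔ imageSpan G W := by
      rw [imageSpan, Submodule.span_le]
      rintro _ ⟨x, hx, rfl⟩
      obtain ⟨v, hv, w, hw, rfl⟩ := Submodule.mem_sup.mp hx
      have h : G *ᵥ (algebraMap F L ∘ (v + w)) =
          G *ᵥ (algebraMap F L ∘ v) + G *ᵥ (algebraMap F L ∘ w) := by
        rw [← Matrix.mulVec_add]
        congr 1
        ext j
        simp
      show G *ᵥ (algebraMap F L ∘ (v + w)) ∈ _
      rw [h]
      exact Submodule.add_mem_sup (Submodule.subset_span ⟨v, hv, rfl⟩)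
        (Submodule.subset_span ⟨w, hw, rfl⟩)
    have hinf : imageSpan G (V ⊓ W) ≤ imageSpan G V ⊓ imageSpan G W :=
      le_inf (Submodule.span_mono (Set.image_mono (fun _ h => h.1)))
        (Submodule.span_mono (Set.image_mono (fun _ h => h.2)))
    calc _ ≤ Module.finrank L ↥(imageSpan G V ⊔ imageSpan G W) +
          Module.finrank L ↥(imageSpan G V ⊓ imageSpan G W) :=
          Nat.add_le_add (Submodule.finrank_mono hsup) (Submodule.finrank_mono hinf)
      _ = _ := Submodule.finrank_sup_add_finrank_inf_eq _ _

/-- The rank function of the represented `q`-matroid is `rowSpace Y ↦ rk (G Yᵀ)`. -/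
theorem QMatroid.ofMatrix_rank_rowSpace {F L : Type*} [Field F] [Field L] [Algebra F L]
    {k n r : ℕ} (G : Matrix (Fin k) (Fin n) L) (Y : Matrix (Fin r) (Fin n) F) :
    (QMatroid.ofMatrix F G).rank (rowSpace Y) = (G * (Y.map (algebraMap F L))ᵀ).rank := by
  show Module.finrank L (imageSpan G (rowSpace Y)) = _
  rw [imageSpan_rowSpace, Matrix.rank]

/-! ### Rank-metric codes and their higher weight enumerators -/

section Codes

variable {F L : Type*} [Field F] [Field L] [Algebra F L] {m n : ℕ}

/-- The `m × n` matrix over `F` whose columns are the coordinate vectors of the entries of `v`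
with respect to the `F`-basis `b` of `L`. -/
def coordMatrix (b : Module.Basis (Fin m) F L) (v : Fin n → L) : Matrix (Fin m) (Fin n) F :=
  Matrix.of fun i j => b.repr (v j) i

/-- The rank support of an `L`-subspace `T ≤ L ^ n`. -/
def rankSupport (b : Module.Basis (Fin m) F L) (T : Submodule L (Fin n → L)) :
    Submodule F (Fin n → F) :=
  ⨆ v ∈ T, rowSpace (coordMatrix b v)

/-- The rank weight of an `L`-subspace `T ≤ L ^ n`. -/
def rankWeight (b : Module.Basis (Fin m) F L) (T : Submodule L (Fin n → L)) : ℕ :=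
  Module.finrank F (rankSupport b T)

/-- The number of `t`-dimensional subcodes of `C` of rank weight `i`. -/
def higherWeightCount (b : Module.Basis (Fin m) F L) (C : Submodule L (Fin n → L))
    (t i : ℕ) : ℕ :=
  Set.ncard {D : Submodule L (Fin n → L) |
    D ≤ C ∧ Module.finrank L D = t ∧ rankWeight b D = i}

/-- The `t`-th higher rank-weight enumerator of `C`. -/
def higherWeightEnumerator (b : Module.Basis (Fin m) F L) (C : Submodule L (Fin n → L))
    (t : ℕ) : MvPolynomial (Fin 2) ℤ :=
  ∑ i ∈ Finset.range (n + 1), (higherWeightCount b C t i : MvPolynomial (Fin 2) ℤ) *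
    (MvPolynomial.X 0 ^ (n - i) * MvPolynomial.X 1 ^ i)

end Codes

/-! ### The two families of polynomials -/

/-- The polynomials substituted for `x ^ a * y ^ c` in the Whitney function. The exponent
`i - n + k - a + c` is truncated at `0`; it is negative only where the first Gaussian binomial
coefficient vanishes. -/
def subU (q m n k t a c : ℕ) : MvPolynomial (Fin 2) ℤ :=
  if a ≤ k ∧ c ≤ n - k then
    ∑ i ∈ Finset.range (n + 1),
      MvPolynomial.C ((-1 : ℤ) ^ (i + (k - a + c) - n) *
          (q : ℤ) ^ (i + (k - a + c) - n).choose 2 *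
          gaussBinom q (k - a + c) (n - i) * gaussBinom (q ^ m) a t) *
        (MvPolynomial.X 0 ^ (n - i) * MvPolynomial.X 1 ^ i)
  else 0

/-- The polynomials substituted for `x ^ i * y ^ j` in the `t`-th higher weight enumerator. The
exponent `t - a` is truncated at `0`; it is negative only where the first Gaussian binomial
coefficient vanishes. -/
def subUHat (q m n k t i j : ℕ) : MvPolynomial (Fin 2) ℤ :=
  if i + j = n then
    ∑ a ∈ Finset.range (k + 1), ∑ c ∈ Finset.range (n - k + 1),
      MvPolynomial.C ((-1 : ℤ) ^ (t - a) * (q : ℤ) ^ (m * (t - a).choose 2) *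
          gaussBinom (q ^ m) t a * gaussBinom q (n - j) (k + c - a)) *
        (MvPolynomial.X 0 ^ a * MvPolynomial.X 1 ^ c)
  else 0

end

/-! ### Gaussian inversion -/

/-! Double counting of pairs `(T, V)`, with `T` a `t`-dimensional subcode and `V ≤ F ^ n`, such that
every word of `T` is orthogonal to `V`, combined with Gaussian inversion on either side. For fixed
`V`, these `T` are the `t`-dimensional subspaces of a subcode of dimension `k - ρ(V)`, so there are
`[k - ρ(V), t]` of them in base `q ^ m` (`finrank_orthogonalSubcode`, `ncard_subcode_orthogonal`).
For fixed `T`, these `V` are the subspaces of the orthogonal complement of the rank support, of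
dimension `n - wt(T)` (`le_orthogonalSubcode_iff`).

For (a), weight each `V` by the base-`q` inversion coefficient of `dim V` and `n - i`: the sum over
the `V` belonging to `T` becomes the indicator of `wt(T) = i`. For (b), weight each `T` by the
base-`q ^ m` inversion coefficient of `t` and `a`: the sum over the `T` belonging to `V` becomes the
indicator of `k - ρ(V) = a`. Both collapses are `sum_gaussBinom_mul_gaussInvCoeff`. -/

theorem gaussBinom_eq_zero_of_lt (q : ℕ) {n j : ℕ} (h : n < j) : gaussBinom q n j = 0 := by
  induction n generalizing j with
  | zero =>
    obtain ⟨j, rfl⟩ := Nat.exists_eq_succ_of_ne_zero h.ne'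
    rfl
  | succ n ih =>
    obtain ⟨j, rfl⟩ := Nat.exists_eq_succ_of_ne_zero (Nat.ne_zero_of_lt h)
    rw [gaussBinom, ih (by omega), ih (by omega)]
    simp

/-- The coefficient `(-1) ^ (d - j) * q ^ ((d - j).choose 2) * [d, j]_q` of Gaussian inversion. -/
def gaussInvCoeff (q d j : ℕ) : ℤ :=
  (-1) ^ (d - j) * (q : ℤ) ^ (d - j).choose 2 * gaussBinom q d j

/-- `gaussInvCoeff q d j` is the coefficient of `X ^ j` in `∏ i < d, (X - q ^ i)`; this recursion
and the next one express multiplication by `X - q ^ d`. -/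
theorem gaussInvCoeff_succ_zero (q d : ℕ) :
    gaussInvCoeff q (d + 1) 0 = -((q : ℤ) ^ d * gaussInvCoeff q d 0) := by
  simp only [gaussInvCoeff, gaussBinom, Nat.sub_zero, Nat.choose_succ_succ' d 1, Nat.choose_one_right]
  ring

theorem gaussInvCoeff_succ_succ (q d j : ℕ) :
    gaussInvCoeff q (d + 1) (j + 1) =
      gaussInvCoeff q d j - (q : ℤ) ^ d * gaussInvCoeff q d (j + 1) := by
  simp only [gaussInvCoeff, gaussBinom, Nat.add_sub_add_right]
  rcases lt_or_ge d (j + 1) with h | h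
  · rw [gaussBinom_eq_zero_of_lt q h]
    simp
  · obtain ⟨e, rfl⟩ := Nat.exists_eq_add_of_le h
    have h1 : j + 1 + e - j = e + 1 := by omega
    have h2 : j + 1 + e - (j + 1) = e := by omega
    rw [h1, h2, Nat.choose_succ_succ' e 1, Nat.choose_one_right]
    push_cast
    ring

/-- The matrices of Gaussian binomial coefficients and of Gaussian inversion coefficients are
inverse to each other. -/
theorem sum_gaussBinom_mul_gaussInvCoeff (q s j : ℕ) {N : ℕ} (hN : s < N) :
    ∑ d ∈ Finset.range N, (gaussBinom q s d : ℤ) * gaussInvCoeff q d j =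
      if s = j then 1 else 0 := by
  induction s generalizing j N with
  | zero =>
    obtain ⟨N, rfl⟩ := Nat.exists_eq_succ_of_ne_zero hN.ne'
    rw [Finset.sum_range_succ', Finset.sum_eq_zero (fun d _ => by simp [gaussBinom])]
    cases j <;> simp [gaussBinom, gaussInvCoeff]
  | succ s ih =>
    obtain ⟨N, rfl⟩ := Nat.exists_eq_succ_of_ne_zero (Nat.ne_zero_of_lt hN)
    -- Expand by `q`-Pascal and regroup by `[s, d]`. In polynomial terms the bracket is the
    -- coefficient of `X ^ j` in `X * ∏ i < d, (X - q ^ i)`, so it vanishes for `j = 0` and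
    -- otherwise reduces to `s` and `j - 1`.
    have key : ∑ d ∈ Finset.range (N + 1), (gaussBinom q (s + 1) d : ℤ) * gaussInvCoeff q d j =
        ∑ d ∈ Finset.range N, (gaussBinom q s d : ℤ) *
          (gaussInvCoeff q (d + 1) j + (q : ℤ) ^ d * gaussInvCoeff q d j) := by
      have h0 : ∑ d ∈ Finset.range N, (gaussBinom q s d : ℤ) *
          ((q : ℤ) ^ d * gaussInvCoeff q d j) = ∑ d ∈ Finset.range (N + 1),
            (gaussBinom q s d : ℤ) * ((q : ℤ) ^ d * gaussInvCoeff q d j) := by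
        rw [Finset.sum_range_succ, gaussBinom_eq_zero_of_lt q (by omega : s < N)]
        simp
      simp only [mul_add, Finset.sum_add_distrib]
      rw [h0, Finset.sum_range_succ', Finset.sum_range_succ' _ N, ← add_assoc,
        ← Finset.sum_add_distrib]
      congr 1
      · refine Finset.sum_congr rfl fun d _ => ?_
        rw [gaussBinom]
        push_cast
        ring
      · simp [gaussBinom]
    rw [key]
    cases j with
    | zero => simp [gaussInvCoeff_succ_zero]
    | succ j =>
      simp only [gaussInvCoeff_succ_succ, sub_add_cancel, Nat.add_right_cancel_iff]
      exact ih j (by omega)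

/-! ### Counting subspaces over a finite field -/

section Counting

variable {K V : Type*} [Field K] [AddCommGroup V] [Module K V]

theorem span_range_subtype_val_of_linearIndependent [FiniteDimensional K V] {d : ℕ}
    {W : Submodule K V} (hW : Module.finrank K W = d) {s : Fin d → W}
    (hs : LinearIndependent K s) :
    Submodule.span K (Set.range fun i => (s i : V)) = W := by
  have h := hs.span_eq_top_of_card_eq_finrank' (by simp [hW])
  have h2 : (Set.range fun i => (s i : V)) = W.subtype '' Set.range s := by
    rw [← Set.range_comp]; rfl
  rw [h2, Submodule.span_image, h, Submodule.map_top, Submodule.range_subtype]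

/-- An independent `d`-tuple is an ordered basis of exactly one `d`-dimensional subspace, its span.
-/
theorem bijective_linearIndependent_sigma [FiniteDimensional K V] (d : ℕ) :
    Function.Bijective (fun x : Σ W : {W : Submodule K V // Module.finrank K W = d},
        {s : Fin d → W.1 // LinearIndependent K s} =>
      (⟨fun i => (x.2.1 i : V), x.2.2.map' x.1.1.subtype (Submodule.ker_subtype _)⟩ :
        {s : Fin d → V // LinearIndependent K s})) := by
  constructor
  · rintro ⟨⟨W, hW⟩, s, hs⟩ ⟨⟨W', hW'⟩, s', hs'⟩ h
    have h1 : (fun i => (s i : V)) = fun i => (s' i : V) := congrArg Subtype.val h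
    have h2 : W = W' := by
      rw [← span_range_subtype_val_of_linearIndependent hW hs,
        ← span_range_subtype_val_of_linearIndependent hW' hs', h1]
    subst h2
    have h3 : s = s' := by
      ext i
      exact congrFun h1 i
    subst h3
    rfl
  · rintro ⟨s, hs⟩
    refine ⟨⟨⟨Submodule.span K (Set.range s), by simpa using finrank_span_eq_card hs⟩,
      fun i => ⟨s i, Submodule.subset_span ⟨i, rfl⟩⟩, ?_⟩, rfl⟩
    exact linearIndependent_span hs

theorem prod_pow_sub_pow (q n d : ℕ) (h : d ≤ n) :
    ∏ i ∈ Finset.range d, ((q : ℤ) ^ n - (q : ℤ) ^ i) =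
      (∏ i ∈ Finset.range d, (q : ℤ) ^ i) * ∏ i ∈ Finset.range d, ((q : ℤ) ^ (n - i) - 1) := by
  rw [← Finset.prod_mul_distrib]
  refine Finset.prod_congr rfl fun i hi => ?_
  rw [mul_sub, ← pow_add, mul_one]
  congr 2
  have := Finset.mem_range.mp hi
  omega

theorem prod_pow_sub_pow_pos {q d n : ℕ} (hq : 1 < q) (h : d ≤ n) :
    0 < ∏ i ∈ Finset.range d, ((q : ℤ) ^ n - (q : ℤ) ^ i) := by
  refine Finset.prod_pos fun i hi => sub_pos.mpr ?_
  exact pow_lt_pow_right₀ (by exact_mod_cast hq) (by have := Finset.mem_range.mp hi; omega)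

theorem natCard_linearIndependent [Finite K] [FiniteDimensional K V] {d : ℕ}
    (h : d ≤ Module.finrank K V) :
    (Nat.card {s : Fin d → V // LinearIndependent K s} : ℤ) =
      ∏ i ∈ Finset.range d,
        ((Nat.card K : ℤ) ^ Module.finrank K V - (Nat.card K : ℤ) ^ i) := by
  have : Fintype K := Fintype.ofFinite K
  have : Finite V := Module.finite_of_finite K
  have : Fintype V := Fintype.ofFinite V
  rw [card_linearIndependent h, Finset.prod_range, Nat.cast_prod, Nat.card_eq_fintype_card]
  refine Finset.prod_congr rfl fun i _ => ?_
  rw [Nat.cast_sub (Nat.pow_le_pow_right Fintype.card_pos (by omega))]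
  push_cast
  rfl

/-- Divide the number of independent `d`-tuples by the number of ordered bases of a single
`d`-dimensional space; the powers `q ^ i` cancel, leaving the product formula. -/
theorem natCard_submodule_finrank_eq [Finite K] [FiniteDimensional K V] (d : ℕ) :
    Nat.card {W : Submodule K V // Module.finrank K W = d} =
      gaussBinom (Nat.card K) (Module.finrank K V) d := by
  have : Finite V := Module.finite_of_finite K
  rcases lt_or_ge (Module.finrank K V) d with h | h
  · rw [gaussBinom_eq_zero_of_lt _ h]
    have : IsEmpty {W : Submodule K V // Module.finrank K W = d} :=
      ⟨fun W => by have := Submodule.finrank_le W.1; omega⟩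
    exact Nat.card_of_isEmpty
  · have hq : 1 < Nat.card K := Finite.one_lt_card
    have : Fintype {W : Submodule K V // Module.finrank K W = d} := Fintype.ofFinite _
    have h1 := Nat.card_eq_of_bijective _ (bijective_linearIndependent_sigma (K := K) (V := V) d)
    rw [Nat.card_sigma] at h1
    have h2 : (Nat.card {W : Submodule K V // Module.finrank K W = d} : ℤ) *
        ∏ i ∈ Finset.range d, ((Nat.card K : ℤ) ^ d - (Nat.card K : ℤ) ^ i) =
        ∏ i ∈ Finset.range d,
          ((Nat.card K : ℤ) ^ Module.finrank K V - (Nat.card K : ℤ) ^ i) := by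
      rw [← natCard_linearIndependent h, ← h1, Nat.cast_sum,
        Finset.sum_congr rfl (fun W _ => (natCard_linearIndependent W.2.ge).trans (by rw [W.2]))]
      simp [Nat.card_eq_fintype_card]
    have h3 := gaussBinom_mul_prod (Nat.card K) (Module.finrank K V) d
    have h4 : ∏ i ∈ Finset.range d, ((Nat.card K : ℤ) ^ (i + 1) - 1) =
        ∏ i ∈ Finset.range d, ((Nat.card K : ℤ) ^ (d - i) - 1) := by
      rw [← Finset.prod_range_reflect]
      refine Finset.prod_congr rfl fun i hi => ?_
      have := Finset.mem_range.mp hi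
      congr 2
      omega
    have h5 := prod_pow_sub_pow_pos hq le_rfl (d := d)
    rw [h4] at h3
    have h6 : (Nat.card {W : Submodule K V // Module.finrank K W = d} : ℤ) =
        gaussBinom (Nat.card K) (Module.finrank K V) d := by
      apply mul_right_cancel₀ h5.ne'
      rw [h2, prod_pow_sub_pow _ _ _ h, prod_pow_sub_pow _ _ _ le_rfl, ← h3]
      ring
    exact_mod_cast h6

/-- The number of `d`-dimensional subspaces of a subspace `S`. -/
theorem ncard_submodule_le_finrank_eq [Finite K] [FiniteDimensional K V] (S : Submodule K V)
    (d : ℕ) :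
    {W : Submodule K V | W ≤ S ∧ Module.finrank K W = d}.ncard =
      gaussBinom (Nat.card K) (Module.finrank K S) d := by
  rw [← natCard_submodule_finrank_eq (V := S)]
  symm
  refine Nat.card_congr (Equiv.ofBijective
    (fun W => ⟨W.1.map S.subtype, Submodule.map_subtype_le _ _, ?_⟩) ⟨?_, ?_⟩)
  · rw [Submodule.finrank_map_subtype_eq, W.2]
  · intro W W' h
    exact Subtype.ext (Submodule.map_injective_of_injective S.injective_subtype
      (congrArg Subtype.val h))
  · rintro ⟨W, hW, hd⟩
    have h : (W.comap S.subtype).map S.subtype = W := by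
      rw [Submodule.map_comap_subtype, inf_eq_right.mpr hW]
    refine ⟨⟨W.comap S.subtype, ?_⟩, Subtype.ext h⟩
    rw [← Submodule.finrank_map_subtype_eq, h, hd]

-- Grouping by dimension turns a sum over the subspaces of `S` into the form handled by Gaussian
-- inversion.
open Classical in
theorem sum_submodule_le_finrank [Finite K] [FiniteDimensional K V] [Fintype (Submodule K V)]
    (S : Submodule K V) (f : ℕ → ℤ) {N : ℕ} (hN : Module.finrank K S < N) :
    ∑ W : Submodule K V with W ≤ S, f (Module.finrank K W) =
      ∑ d ∈ Finset.range N, (gaussBinom (Nat.card K) (Module.finrank K S) d : ℤ) * f d := by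
  rw [← Finset.sum_fiberwise_of_maps_to (t := Finset.range N)
    (g := fun W : Submodule K V => Module.finrank K W)]
  · refine Finset.sum_congr rfl fun d _ => ?_
    rw [Finset.sum_congr rfl (g := fun _ => f d) (by simp +contextual), Finset.sum_const,
      nsmul_eq_mul, ← ncard_submodule_le_finrank_eq, Finset.filter_filter,
      Set.ncard_eq_toFinset_card', Set.toFinset_ofPred]
  · intro W hW
    rw [Finset.mem_range]
    exact (Submodule.finrank_mono (Finset.mem_filter.mp hW).2).trans_lt hN

end Counting

/-! ### Orthogonal complements for the dot product -/

/-- The orthogonal complement of `W ≤ K ^ n` with respect to the dot product. -/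
noncomputable def dotPerp {K : Type*} [Field K] {n : ℕ} (W : Submodule K (Fin n → K)) :
    Submodule K (Fin n → K) :=
  W.dualAnnihilator.comap (dotProductEquiv K (Fin n)).toLinearMap

theorem mem_dotPerp {K : Type*} [Field K] {n : ℕ} {W : Submodule K (Fin n → K)}
    {v : Fin n → K} : v ∈ dotPerp W ↔ ∀ w ∈ W, v ⬝ᵥ w = 0 := by
  simp [dotPerp, Submodule.mem_dualAnnihilator]

theorem finrank_add_finrank_dotPerp {K : Type*} [Field K] {n : ℕ}
    (W : Submodule K (Fin n → K)) :
    Module.finrank K W + Module.finrank K (dotPerp W) = n := by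
  have h := Subspace.finrank_add_finrank_dualAnnihilator_eq W
  have h2 : Module.finrank K (dotPerp W) = Module.finrank K W.dualAnnihilator :=
    ((dotProductEquiv K (Fin n)).ofSubmodule' W.dualAnnihilator).finrank_eq
  rw [h2, h, Module.finrank_fin_fun]

/-! ### Orthogonality between subcodes and subspaces of `F ^ n`. -/

section Codes

variable {F L : Type*} [Field F] [Field L] [Algebra F L] {m k n : ℕ}

/-- Coordinates are `F`-linear and `v` has entries in `F`. Hence orthogonality over `F` to all rows
of the matrix is the single equation `c ⬝ᵥ v = 0` over `L`. -/
theorem coordMatrix_mulVec (b : Module.Basis (Fin m) F L) (c : Fin n → L) (v : Fin n → F) :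
    coordMatrix b c *ᵥ v = b.equivFun (c ⬝ᵥ (algebraMap F L ∘ v)) := by
  ext i
  have h : c ⬝ᵥ (algebraMap F L ∘ v) = ∑ j, v j • c j := by
    simp [dotProduct, Algebra.smul_def, mul_comm]
  rw [h]
  simp [Matrix.mulVec, dotProduct, coordMatrix, mul_comm]

/-- A vector over `F` is orthogonal to the rank support of `T` iff it is orthogonal to `T`. -/
theorem mem_dotPerp_rankSupport (b : Module.Basis (Fin m) F L) {T : Submodule L (Fin n → L)}
    {v : Fin n → F} :
    v ∈ dotPerp (rankSupport b T) ↔ ∀ c ∈ T, c ⬝ᵥ (algebraMap F L ∘ v) = 0 := by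
  have hrow : ∀ c : Fin n → L, (∀ w ∈ rowSpace (coordMatrix b c), v ⬝ᵥ w = 0) ↔
      c ⬝ᵥ (algebraMap F L ∘ v) = 0 := by
    intro c
    have h1 : ∀ u, v ⬝ᵥ (u ᵥ* coordMatrix b c) = u ⬝ᵥ b.equivFun (c ⬝ᵥ (algebraMap F L ∘ v)) := by
      intro u
      rw [dotProduct_comm, ← Matrix.dotProduct_mulVec, coordMatrix_mulVec]
    constructor
    · intro h
      rw [← b.equivFun.map_eq_zero_iff]
      refine dotProduct_eq_zero _ fun u => ?_
      rw [dotProduct_comm, ← h1]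
      exact h _ ⟨u, rfl⟩
    · rintro h _ ⟨u, rfl⟩
      rw [Matrix.vecMulLinear_apply, h1, h]
      simp
  -- Containment in the kernel of a functional can be tested on each member of the supremum.
  have hker : v ∈ dotPerp (rankSupport b T) ↔
      rankSupport b T ≤ LinearMap.ker (dotProductEquiv F (Fin n) v) := by
    rw [mem_dotPerp]
    rfl
  rw [hker, rankSupport, iSup₂_le_iff]
  exact forall₂_congr fun c _ => hrow c

/-- The subcode of `rowSpace G` consisting of the words orthogonal to `V`. -/
noncomputable def orthogonalSubcode (G : Matrix (Fin k) (Fin n) L)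
    (V : Submodule F (Fin n → F)) : Submodule L (Fin n → L) :=
  (dotPerp (imageSpan G V)).map G.vecMulLinear

theorem mem_dotPerp_imageSpan {G : Matrix (Fin k) (Fin n) L} {V : Submodule F (Fin n → F)}
    {u : Fin k → L} :
    u ∈ dotPerp (imageSpan G V) ↔ ∀ v ∈ V, (u ᵥ* G) ⬝ᵥ (algebraMap F L ∘ v) = 0 := by
  have hker : u ∈ dotPerp (imageSpan G V) ↔
      imageSpan G V ≤ LinearMap.ker (dotProductEquiv L (Fin k) u) := by
    rw [mem_dotPerp]
    rfl
  rw [hker, imageSpan, Submodule.span_le, Set.image_subset_iff]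
  refine forall₂_congr fun v _ => ?_
  rw [← Matrix.dotProduct_mulVec]
  rfl

/-- For `T` inside the code, both sides say that every word of `T` is orthogonal to `V`. This is the
incidence relation of the double count. -/
theorem le_orthogonalSubcode_iff (b : Module.Basis (Fin m) F L) {G : Matrix (Fin k) (Fin n) L}
    {V : Submodule F (Fin n → F)} {T : Submodule L (Fin n → L)} :
    T ≤ orthogonalSubcode G V ↔ T ≤ rowSpace G ∧ V ≤ dotPerp (rankSupport b T) := by
  constructor
  · intro h
    constructor
    · exact h.trans LinearMap.map_le_range
    · intro v hv
      rw [mem_dotPerp_rankSupport]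
      intro c hc
      obtain ⟨u, hu, rfl⟩ := h hc
      exact mem_dotPerp_imageSpan.mp hu v hv
  · rintro ⟨h1, h2⟩ c hc
    obtain ⟨u, rfl⟩ := h1 hc
    exact ⟨u, mem_dotPerp_imageSpan.mpr fun v hv =>
      (mem_dotPerp_rankSupport b).mp (h2 hv) _ hc, rfl⟩

theorem vecMulLinear_injective_of_rank_eq {G : Matrix (Fin k) (Fin n) L} (hG : G.rank = k) :
    Function.Injective G.vecMulLinear := by
  have h := G.vecMulLinear.finrank_range_add_finrank_ker
  rw [range_vecMulLinear, ← Matrix.rank_eq_finrank_span_row, hG, Module.finrank_fin_fun] at h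
  rw [← LinearMap.ker_eq_bot]
  exact Submodule.finrank_eq_zero.mp (by omega)

theorem finrank_orthogonalSubcode {G : Matrix (Fin k) (Fin n) L} (hG : G.rank = k)
    (V : Submodule F (Fin n → F)) :
    Module.finrank L (orthogonalSubcode G V) = k - (QMatroid.ofMatrix F G).rank V := by
  rw [orthogonalSubcode, ← ((dotPerp (imageSpan G V)).equivMapOfInjective _
    (vecMulLinear_injective_of_rank_eq hG)).finrank_eq]
  have h := finrank_add_finrank_dotPerp (imageSpan G V)
  change _ = k - Module.finrank L (imageSpan G V)
  omega

/-- The number of `t`-dimensional subcodes whose rank support is orthogonal to `V`. -/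
theorem ncard_subcode_orthogonal [Finite L] (b : Module.Basis (Fin m) F L)
    {G : Matrix (Fin k) (Fin n) L} (hG : G.rank = k) (V : Submodule F (Fin n → F)) (t : ℕ) :
    {T : Submodule L (Fin n → L) | (T ≤ rowSpace G ∧ Module.finrank L T = t) ∧
      V ≤ dotPerp (rankSupport b T)}.ncard =
      gaussBinom (Nat.card L) (k - (QMatroid.ofMatrix F G).rank V) t := by
  rw [← finrank_orthogonalSubcode hG, ← ncard_submodule_le_finrank_eq]
  congr 1
  ext T
  simp only [Set.mem_ofPred_eq, le_orthogonalSubcode_iff b]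
  tauto

/-! ### Rank and nullity in the represented `q`-matroid -/

theorem QMatroid.ofMatrix_rank_top (G : Matrix (Fin k) (Fin n) L) :
    (QMatroid.ofMatrix F G).rank ⊤ = G.rank := by
  have h := QMatroid.ofMatrix_rank_rowSpace (F := F) G (1 : Matrix (Fin n) (Fin n) F)
  have h1 : rowSpace (1 : Matrix (Fin n) (Fin n) F) = ⊤ :=
    LinearMap.range_eq_top.mpr fun v => ⟨v, by simp⟩
  rw [h1] at h
  rw [h]
  simp

/-- For a complement `W` of `V`, submodularity gives `ρ(E) ≤ ρ(V) + ρ(W) ≤ ρ(V) + dim E - dim V`. It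
keeps the exponents of `y` within the range where the substitution is not the default `0`. -/
theorem QMatroid.nullity_le {E : Type*} [AddCommGroup E] [Module F E] [FiniteDimensional F E]
    (M : QMatroid F E) (V : Submodule F E) :
    Module.finrank F V - M.rank V ≤ Module.finrank F E - M.rank ⊤ := by
  obtain ⟨W, hW⟩ := V.exists_isCompl
  have h1 := M.rank_submodular V W
  rw [hW.sup_eq_top] at h1
  have h2 := M.rank_le_finrank W
  have h3 := Submodule.finrank_add_eq_of_isCompl hW
  have h4 := M.rank_le_finrank V
  omega

/-! ### The higher weight enumerator as a sum over subcodes -/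

open Classical in
/-- The finite set of `t`-dimensional subcodes of `C`. -/
noncomputable def subcodes [Fintype (Submodule L (Fin n → L))] (C : Submodule L (Fin n → L))
    (t : ℕ) : Finset (Submodule L (Fin n → L)) :=
  {T | T ≤ C ∧ Module.finrank L T = t}

/-- The dimension of the orthogonal complement of the rank support of `T`. -/
noncomputable def coweight (b : Module.Basis (Fin m) F L) (T : Submodule L (Fin n → L)) : ℕ :=
  Module.finrank F (dotPerp (rankSupport b T))

theorem rankWeight_add_coweight (b : Module.Basis (Fin m) F L) (T : Submodule L (Fin n → L)) :
    rankWeight b T + coweight b T = n :=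
  finrank_add_finrank_dotPerp _

theorem higherWeightCount_eq_sum [Fintype (Submodule L (Fin n → L))]
    (b : Module.Basis (Fin m) F L) (C : Submodule L (Fin n → L)) {t i : ℕ} (hi : i ≤ n) :
    (higherWeightCount b C t i : ℤ) =
      ∑ T ∈ subcodes C t, if coweight b T = n - i then 1 else 0 := by
  classical
  rw [Finset.sum_boole, higherWeightCount, Set.ncard_eq_toFinset_card', Set.toFinset_ofPred]
  congr 2
  ext T
  have := rankWeight_add_coweight b T
  have h : rankWeight b T = i ↔ coweight b T = n - i := by omega
  simp [subcodes, h, and_assoc]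

theorem higherWeightEnumerator_eq_sum [Fintype (Submodule L (Fin n → L))]
    (b : Module.Basis (Fin m) F L) (C : Submodule L (Fin n → L)) (t : ℕ) :
    higherWeightEnumerator b C t = ∑ T ∈ subcodes C t,
      MvPolynomial.X 0 ^ coweight b T * MvPolynomial.X 1 ^ rankWeight b T := by
  classical
  rw [← Finset.sum_fiberwise_of_maps_to (t := Finset.range (n + 1)) (g := rankWeight b)]
  · refine Finset.sum_congr rfl fun i hi => ?_
    rw [Finset.sum_congr rfl (g := fun _ => MvPolynomial.X 0 ^ (n - i) * MvPolynomial.X 1 ^ i)]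
    · rw [Finset.sum_const, nsmul_eq_mul, higherWeightCount, Set.ncard_eq_toFinset_card',
        Set.toFinset_ofPred, subcodes, Finset.filter_filter]
      simp only [and_assoc]
    · intro T hT
      have h1 := rankWeight_add_coweight b T
      have h2 : rankWeight b T = i := (Finset.mem_filter.mp hT).2
      have h3 : coweight b T = n - i := by omega
      rw [h2, h3]
  · intro T _
    have := rankWeight_add_coweight b T
    simp only [Finset.mem_range]
    omega

open Classical in
theorem sum_subcodes_orthogonal [Finite L] [Fintype (Submodule L (Fin n → L))]
    (b : Module.Basis (Fin m) F L) {G : Matrix (Fin k) (Fin n) L} (hG : G.rank = k)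
    (V : Submodule F (Fin n → F)) (t : ℕ) :
    ∑ T ∈ subcodes (rowSpace G) t, (if V ≤ dotPerp (rankSupport b T) then 1 else 0 : ℤ) =
      gaussBinom (Nat.card L) (k - (QMatroid.ofMatrix F G).rank V) t := by
  rw [Finset.sum_boole, ← ncard_subcode_orthogonal b hG, Set.ncard_eq_toFinset_card',
    Set.toFinset_ofPred, subcodes, Finset.filter_filter]

end Codes

/-! ### Coefficient identities from the double count. -/

section Identities

open MvPolynomial

theorem subU_eq_sum {q m n k t a c : ℕ} (ha : a ≤ k) (hc : c ≤ n - k) :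
    subU q m n k t a c = ∑ i ∈ Finset.range (n + 1),
      C (gaussInvCoeff q (k - a + c) (n - i) * gaussBinom (q ^ m) a t) *
        (X 0 ^ (n - i) * X 1 ^ i) := by
  rw [subU, if_pos ⟨ha, hc⟩]
  refine Finset.sum_congr rfl fun i hi => ?_
  have h : i + (k - a + c) - n = k - a + c - (n - i) := by
    have := Finset.mem_range.mp hi
    omega
  rw [h, gaussInvCoeff]

theorem subUHat_eq_sum {q m n k t i j : ℕ} (h : i + j = n) :
    subUHat q m n k t i j = ∑ a ∈ Finset.range (k + 1), ∑ c ∈ Finset.range (n - k + 1),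
      C (gaussInvCoeff (q ^ m) t a * gaussBinom q i (k + c - a)) * (X 0 ^ a * X 1 ^ c) := by
  have h2 : n - j = i := by omega
  rw [subUHat, if_pos h, h2]
  simp only [gaussInvCoeff, Nat.cast_pow, pow_mul]

variable {F L : Type*} [Field F] [Field L] [Algebra F L] {m k n : ℕ}

theorem natCard_eq_pow_of_basis [Finite F] (b : Module.Basis (Fin m) F L) :
    Nat.card L = Nat.card F ^ m := by
  have : Module.Finite F L := Module.Finite.of_basis b
  rw [Module.natCard_eq_pow_finrank (K := F), Module.finrank_eq_card_basis b, Fintype.card_fin]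

theorem whitney_ofMatrix_eq_sum [Fintype (Submodule F (Fin n → F))]
    {G : Matrix (Fin k) (Fin n) L} (hG : G.rank = k) :
    (QMatroid.ofMatrix F G).whitney = ∑ V : Submodule F (Fin n → F),
      X 0 ^ (k - (QMatroid.ofMatrix F G).rank V) *
        X 1 ^ (Module.finrank F V - (QMatroid.ofMatrix F G).rank V) := by
  rw [QMatroid.whitney, finsum_eq_sum_of_fintype, QMatroid.ofMatrix_rank_top, hG]

theorem ofMatrix_rank_le {G : Matrix (Fin k) (Fin n) L} (hG : G.rank = k)
    (V : Submodule F (Fin n → F)) : (QMatroid.ofMatrix F G).rank V ≤ k :=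
  ((QMatroid.ofMatrix F G).rank_mono V ⊤ le_top).trans
    ((QMatroid.ofMatrix_rank_top G).trans hG).le

theorem ofMatrix_nullity_le {G : Matrix (Fin k) (Fin n) L} (hG : G.rank = k)
    (V : Submodule F (Fin n → F)) :
    Module.finrank F V - (QMatroid.ofMatrix F G).rank V ≤ n - k := by
  have h := (QMatroid.ofMatrix F G).nullity_le V
  rwa [QMatroid.ofMatrix_rank_top, hG, Module.finrank_fin_fun] at h

/-- Write the second binomial as a count of the `T` orthogonal to `V` and exchange sums; inversion
over `V ≤ dotPerp (rankSupport b T)` leaves the indicator of coweight `n - i`. -/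
theorem higherWeightCount_eq_sum_gaussInvCoeff [Finite F] [Finite L]
    [Fintype (Submodule F (Fin n → F))]
    (b : Module.Basis (Fin m) F L) {G : Matrix (Fin k) (Fin n) L} (hG : G.rank = k)
    (t : ℕ) {i : ℕ} (hi : i ≤ n) :
    (higherWeightCount b (rowSpace G) t i : ℤ) = ∑ V : Submodule F (Fin n → F),
      gaussInvCoeff (Nat.card F) (Module.finrank F V) (n - i) *
        gaussBinom (Nat.card L) (k - (QMatroid.ofMatrix F G).rank V) t := by
  classical
  have : Fintype (Submodule L (Fin n → L)) := Fintype.ofFinite _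
  simp_rw [higherWeightCount_eq_sum b _ hi, ← sum_subcodes_orthogonal b hG, Finset.mul_sum]
  rw [Finset.sum_comm]
  refine Finset.sum_congr rfl fun T _ => ?_
  simp_rw [mul_ite, mul_one, mul_zero]
  rw [← Finset.sum_filter, sum_submodule_le_finrank (dotPerp (rankSupport b T))
    (fun d => gaussInvCoeff (Nat.card F) d (n - i)) (Nat.lt_succ_self _),
    sum_gaussBinom_mul_gaussInvCoeff _ _ _ (Nat.lt_succ_self _)]
  rfl

/-- The coefficient of `x ^ a * y ^ c` in the Whitney function, in terms of subcodes. -/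
theorem sum_gaussInvCoeff_mul_gaussBinom_coweight [Finite F] [Finite L]
    [Fintype (Submodule F (Fin n → F))] [Fintype (Submodule L (Fin n → L))]
    (b : Module.Basis (Fin m) F L) {G : Matrix (Fin k) (Fin n) L} (hG : G.rank = k)
    (a d : ℕ) :
    ∑ t ∈ Finset.range (k + 1), ∑ T ∈ subcodes (rowSpace G) t,
      gaussInvCoeff (Nat.card L) t a * gaussBinom (Nat.card F) (coweight b T) d =
    ∑ V : Submodule F (Fin n → F),
      if k - (QMatroid.ofMatrix F G).rank V = a ∧ Module.finrank F V = d then (1 : ℤ) else 0 := by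
  classical
  have hcount : ∀ T : Submodule L (Fin n → L),
      (gaussBinom (Nat.card F) (coweight b T) d : ℤ) = ∑ V : Submodule F (Fin n → F),
        (if V ≤ dotPerp (rankSupport b T) then 1 else 0) *
          if Module.finrank F V = d then 1 else 0 := by
    intro T
    rw [coweight, ← ncard_submodule_le_finrank_eq, Set.ncard_eq_toFinset_card',
      Set.toFinset_ofPred]
    simp [← ite_and, Finset.sum_boole, and_comm]
  -- Inversion over `L` for a fixed `V`; the range `t ≤ k` suffices because `k - ρ(V) ≤ k`.
  have hV : ∀ V : Submodule F (Fin n → F),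
      (if k - (QMatroid.ofMatrix F G).rank V = a ∧ Module.finrank F V = d then (1 : ℤ) else 0) =
        ∑ t ∈ Finset.range (k + 1), ∑ T ∈ subcodes (rowSpace G) t,
          gaussInvCoeff (Nat.card L) t a * ((if V ≤ dotPerp (rankSupport b T) then 1 else 0) *
            if Module.finrank F V = d then 1 else 0) := by
    intro V
    have h := sum_gaussBinom_mul_gaussInvCoeff (Nat.card L)
      (k - (QMatroid.ofMatrix F G).rank V) a (Nat.lt_succ_of_le (Nat.sub_le _ _) :
        _ < k + 1)
    simp_rw [← mul_assoc, ← Finset.sum_mul, ← Finset.mul_sum, sum_subcodes_orthogonal b hG]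
    rw [Finset.sum_congr rfl fun t _ => mul_comm _ _, h]
    rw [ite_and, mul_ite, mul_one, mul_zero]
    split_ifs <;> rfl
  simp_rw [hV, hcount, Finset.mul_sum]
  rw [Finset.sum_congr rfl fun t _ => Finset.sum_comm, Finset.sum_comm]

end Identities

theorem mainTheorem2 {F L : Type*} [Field F] [Finite F] [Field L] [Algebra F L] {m k n : ℕ}
    (b : Module.Basis (Fin m) F L) (G : Matrix (Fin k) (Fin n) L) (hG : G.rank = k) :
    (∀ t ≤ k, higherWeightEnumerator b (rowSpace G) t =
      monomialSubst (subU (Nat.card F) m n k t) (QMatroid.ofMatrix F G).whitney) ∧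
    (QMatroid.ofMatrix F G).whitney =
      ∑ t ∈ Finset.range (k + 1), monomialSubst (subUHat (Nat.card F) m n k t)
        (higherWeightEnumerator b (rowSpace G) t) := by
  classical
  have : Module.Finite F L := Module.Finite.of_basis b
  have : Finite L := Module.finite_of_finite F
  have : Fintype (Submodule F (Fin n → F)) := Fintype.ofFinite _
  have : Fintype (Submodule L (Fin n → L)) := Fintype.ofFinite _
  have hL := natCard_eq_pow_of_basis b
  constructor
  · intro t _
    have hV : ∀ V : Submodule F (Fin n → F),
        subU (Nat.card F) m n k t (k - (QMatroid.ofMatrix F G).rank V)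
          (Module.finrank F V - (QMatroid.ofMatrix F G).rank V) =
        ∑ i ∈ Finset.range (n + 1),
          MvPolynomial.C (gaussInvCoeff (Nat.card F) (Module.finrank F V) (n - i) *
            gaussBinom (Nat.card L) (k - (QMatroid.ofMatrix F G).rank V) t) *
          (MvPolynomial.X 0 ^ (n - i) * MvPolynomial.X 1 ^ i) := by
      intro V
      have h1 := ofMatrix_rank_le hG V
      have h2 := (QMatroid.ofMatrix F G).rank_le_finrank V
      -- The exponents `a = k - ρ(V)` and `c = dim V - ρ(V)` recover `dim V = k - a + c`.
      have h3 : k - (k - (QMatroid.ofMatrix F G).rank V) +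
          (Module.finrank F V - (QMatroid.ofMatrix F G).rank V) = Module.finrank F V := by omega
      rw [subU_eq_sum (Nat.sub_le _ _) (ofMatrix_nullity_le hG V), h3, hL]
    rw [whitney_ofMatrix_eq_sum hG, map_sum]
    simp_rw [monomialSubst_monomial, hV]
    rw [Finset.sum_comm, higherWeightEnumerator]
    refine Finset.sum_congr rfl fun i hi => ?_
    rw [← Finset.sum_mul, ← map_sum, ← higherWeightCount_eq_sum_gaussInvCoeff b hG t
      (Nat.lt_succ_iff.mp (Finset.mem_range.mp hi))]
    simp
  · have hT : ∀ t, monomialSubst (subUHat (Nat.card F) m n k t)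
        (higherWeightEnumerator b (rowSpace G) t) =
        ∑ T ∈ subcodes (rowSpace G) t, ∑ a ∈ Finset.range (k + 1),
          ∑ c ∈ Finset.range (n - k + 1),
            MvPolynomial.C (gaussInvCoeff (Nat.card L) t a *
              gaussBinom (Nat.card F) (coweight b T) (k + c - a)) *
            (MvPolynomial.X 0 ^ a * MvPolynomial.X 1 ^ c) := by
      intro t
      rw [higherWeightEnumerator_eq_sum, map_sum]
      refine Finset.sum_congr rfl fun T _ => ?_
      rw [monomialSubst_monomial, subUHat_eq_sum (by
        rw [add_comm]; exact rankWeight_add_coweight b T), hL]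
    have hswap : ∑ t ∈ Finset.range (k + 1), monomialSubst (subUHat (Nat.card F) m n k t)
        (higherWeightEnumerator b (rowSpace G) t) =
        ∑ a ∈ Finset.range (k + 1), ∑ c ∈ Finset.range (n - k + 1),
          MvPolynomial.C (∑ t ∈ Finset.range (k + 1), ∑ T ∈ subcodes (rowSpace G) t,
            gaussInvCoeff (Nat.card L) t a *
              gaussBinom (Nat.card F) (coweight b T) (k + c - a)) *
          (MvPolynomial.X 0 ^ a * MvPolynomial.X 1 ^ c) := by
      simp_rw [hT, map_sum, Finset.sum_mul]
      rw [Finset.sum_congr rfl fun t _ => Finset.sum_comm, Finset.sum_comm]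
      refine Finset.sum_congr rfl fun a _ => ?_
      rw [Finset.sum_congr rfl fun t _ => Finset.sum_comm, Finset.sum_comm]
    rw [hswap, whitney_ofMatrix_eq_sum hG]
    simp_rw [sum_gaussInvCoeff_mul_gaussBinom_coweight b hG, map_sum, Finset.sum_mul]
    rw [Finset.sum_congr rfl fun a _ => Finset.sum_comm, Finset.sum_comm]
    refine Finset.sum_congr rfl fun V _ => ?_
    have h1 := ofMatrix_rank_le hG V
    have h2 := (QMatroid.ofMatrix F G).rank_le_finrank V
    have h3 := ofMatrix_nullity_le hG V
    -- Each `V` meets only one pair `(a, c)`: `a = k - ρ(V)` is forced, and then `dim V = k + c - a`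
    -- forces `c = dim V - ρ(V)`.
    rw [Finset.sum_eq_single_of_mem (k - (QMatroid.ofMatrix F G).rank V)
      (Finset.mem_range.mpr (by omega)) (fun a _ ha => Finset.sum_eq_zero fun c _ => by
        rw [if_neg (fun h => ha h.1.symm)]; simp),
      Finset.sum_eq_single_of_mem (Module.finrank F V - (QMatroid.ofMatrix F G).rank V)
      (Finset.mem_range.mpr (by omega)) (fun c _ hc => by
        rw [if_neg (fun h => hc (by omega))]; simp),
      if_pos ⟨rfl, by omega⟩]
    simp
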